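/- Let $R$ be a commutative valuation ring, possibly with zero-divisors, i.e. a commutative ring whose ideals are totally ordered by inclusion, and let $Q$ be its total quotient ring (the localization of $R$ at the set of all its non-zero-divisors). An $R$-module $M$ is called finitely projective (respectively singly projective) if for every finitely generated (respectively cyclic) submodule $N$ of $M$ the inclusion map $N\to M$ factors through a free $R$-module. A commutative ring $S$ is called maximal if every family of cosets $\{a_i+L_i\mid i\in I\}$, with $a_i\in S$ and $L_i$ ideals of $S$, that has the finite intersection property has a non-empty intersection. Then $Q$ is self-injective (injective as a module over itself) if and only if every singly projective $R$-module is finitely projective. Moreover, $Q$ is self-injective if and only if $Q$ is maximal. -/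

import Mathlib

universe u v

/-- A module is uniserial if its submodules are totally ordered by inclusion. -/
def IsUniserialModule (R : Type u) [CommRing R] (M : Type v) [AddCommGroup M] [Module R M] :
    Prop :=
  ∀ N N' : Submodule R M, N ≤ N' ∨ N' ≤ N

/-- A commutative ring, possibly with zero-divisors, is a (generalized) valuation ring if it is
uniserial as a module over itself. (Mathlib's `ValuationRing` is restricted to domains.) -/
def IsUniserialRing (R : Type u) [CommRing R] : Prop :=
  IsUniserialModule R R

/-- The inclusion of the submodule `N` into `M` factors through a free module. -/
def InclusionFactorsThroughFree {R : Type u} [CommRing R] {M : Type v} [AddCommGroup M]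
    [Module R M] (N : Submodule R M) : Prop :=
  ∃ (F : Type (max u v)) (_ : AddCommGroup F) (_ : Module R F),
    Module.Free R F ∧ ∃ (φ : N →ₗ[R] F) (π : F →ₗ[R] M), π ∘ₗ φ = N.subtype

/-- `M` is finitely projective if the inclusion of every finitely generated submodule factors
through a free module. -/
def IsFinitelyProjective (R : Type u) [CommRing R] (M : Type v) [AddCommGroup M] [Module R M] :
    Prop :=
  ∀ N : Submodule R M, N.FG → InclusionFactorsThroughFree N

/-- `M` is singly projective if the inclusion of every cyclic submodule factors through a free
module. -/
def IsSinglyProjective (R : Type u) [CommRing R] (M : Type v) [AddCommGroup M] [Module R M] :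
    Prop :=
  ∀ N : Submodule R M, N.IsPrincipal → InclusionFactorsThroughFree N

/-- `R` is maximal if every family of cosets `a i + L i` of ideals with the finite intersection
property has non-empty intersection. -/
def IsMaximalRing (R : Type u) [CommRing R] : Prop :=
  ∀ (I : Type u) (a : I → R) (L : I → Ideal R),
    (∀ s : Finset I, ∃ x : R, ∀ i ∈ s, x - a i ∈ L i) → ∃ x : R, ∀ i, x - a i ∈ L i

/-- `R` is self-injective if it is injective as a module over itself. -/
def IsSelfInjective (R : Type u) [CommRing R] : Prop :=
  Module.Injective R R

/-! ### Divisibility in uniserial rings and modules -/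

/-! Over a valuation ring, single projectivity amounts to `HasScalarFactorization`. Since every
non-zero-divisor of `Q` is a unit, principal ideals of `Q` are double annihilators
(`dvd_of_annihilator_le`), so every map from a principal ideal to `Q` is a multiplication. A map
from any ideal is then a compatible family of cosets modulo annihilators. Maximality supplies a
common multiplier, making `Q` injective over both `R` and `Q` (`IsMaximalRing.baer`); conversely,
extending such a map supplies a point common to all cosets (`isMaximalRing_of_baer`).

If `Q` is injective over `R`, functionals with values in `Q` peel off the generators of a finitely
generated submodule one at a time (`hasFreeLifts`). Conversely, the injective hull of `Q` is always
singly projective over `R`, and if it is finitely projective it equals `Q`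
(`surjective_of_essential`). -/

/-- Every element has the form `r • m` with the same annihilator as the scalar `r`. -/
def HasScalarFactorization (R : Type u) [CommRing R] (M : Type v) [AddCommGroup M] [Module R M] :
    Prop :=
  ∀ x : M, ∃ (r : R) (m : M), x = r • m ∧ ∀ s : R, s • x = 0 → s * r = 0

theorem IsUniserialModule.exists_smul_eq_or {R : Type u} [CommRing R] {M : Type v}
    [AddCommGroup M] [Module R M] (h : IsUniserialModule R M) (x y : M) :
    (∃ c : R, x = c • y) ∨ ∃ c : R, y = c • x := by
  rcases h (R ∙ x) (R ∙ y) with h | h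
  · obtain ⟨c, hc⟩ := Submodule.mem_span_singleton.1 (h (Submodule.mem_span_singleton_self x))
    exact Or.inl ⟨c, hc.symm⟩
  · obtain ⟨c, hc⟩ := Submodule.mem_span_singleton.1 (h (Submodule.mem_span_singleton_self y))
    exact Or.inr ⟨c, hc.symm⟩

theorem isUniserialModule_of_exists_smul_eq_or {R : Type u} [CommRing R] {M : Type v}
    [AddCommGroup M] [Module R M]
    (h : ∀ x y : M, (∃ c : R, x = c • y) ∨ ∃ c : R, y = c • x) : IsUniserialModule R M := by
  intro N N'
  by_contra! hcon
  obtain ⟨x, hx, hx'⟩ := Set.not_subset.1 hcon.1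
  obtain ⟨y, hy, hy'⟩ := Set.not_subset.1 hcon.2
  rcases h x y with ⟨c, rfl⟩ | ⟨c, rfl⟩
  · exact hx' (N'.smul_mem c hy)
  · exact hy' (N.smul_mem c hx)

theorem IsUniserialRing.dvd_total {R : Type u} [CommRing R] (h : IsUniserialRing R) (a b : R) :
    a ∣ b ∨ b ∣ a := by
  rcases IsUniserialModule.exists_smul_eq_or h b a with ⟨c, hc⟩ | ⟨c, hc⟩
  · exact Or.inl ⟨c, by rw [hc, smul_eq_mul, mul_comm]⟩
  · exact Or.inr ⟨c, by rw [hc, smul_eq_mul, mul_comm]⟩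

theorem IsUniserialModule.exists_mem_forall_smul_eq {R : Type u} [CommRing R] {M : Type v}
    [AddCommGroup M] [Module R M] (h : IsUniserialModule R M) {ι : Type*} (s : Finset ι)
    (hs : s.Nonempty) (x : ι → M) : ∃ i ∈ s, ∀ j ∈ s, ∃ c : R, x j = c • x i := by
  classical
  induction hs using Finset.Nonempty.cons_induction with
  | singleton a => exact ⟨a, by simp, fun j hj => ⟨1, by simp [Finset.mem_singleton.1 hj]⟩⟩
  | cons a s ha hs ih =>
    obtain ⟨i, hi, hmax⟩ := ih
    rcases h.exists_smul_eq_or (x a) (x i) with ⟨c, hc⟩ | ⟨c, hc⟩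
    · refine ⟨i, Finset.mem_cons_of_mem hi, fun j hj => ?_⟩
      rcases Finset.mem_cons.1 hj with rfl | hj
      · exact ⟨c, hc⟩
      · exact hmax j hj
    · refine ⟨a, Finset.mem_cons_self a s, fun j hj => ?_⟩
      rcases Finset.mem_cons.1 hj with rfl | hj
      · exact ⟨1, by simp⟩
      · obtain ⟨d, hd⟩ := hmax j hj
        exact ⟨d * c, by rw [hd, hc, mul_smul]⟩

/-- An element of a free module over a uniserial ring is the multiple of some element by one of
its coordinates. -/
theorem IsUniserialRing.exists_eq_dual_apply_smul {R : Type u} [CommRing R]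
    (hR : IsUniserialRing R) {F : Type v} [AddCommGroup F] [Module R F] [Module.Free R F] (y : F) :
    ∃ (l : F →ₗ[R] R) (m : F), y = l y • m := by
  classical
  let b := Module.Free.chooseBasis R F
  by_cases hy : (b.repr y).support.Nonempty
  · obtain ⟨i, -, hi⟩ :=
      IsUniserialModule.exists_mem_forall_smul_eq hR (b.repr y).support hy (b.repr y)
    choose! c hc using hi
    refine ⟨b.coord i, ∑ j ∈ (b.repr y).support, c j • b j, ?_⟩
    rw [Finset.smul_sum]
    conv_lhs => rw [← b.linearCombination_repr y, Finsupp.linearCombination_apply, Finsupp.sum]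
    refine Finset.sum_congr rfl fun j hj => ?_
    rw [smul_smul, Module.Basis.coord_apply, mul_comm, ← smul_eq_mul, ← hc j hj]
  · refine ⟨0, 0, ?_⟩
    rw [Finset.not_nonempty_iff_eq_empty, Finsupp.support_eq_empty] at hy
    simpa using hy

theorem IsSinglyProjective.hasScalarFactorization {R : Type u} [CommRing R]
    (hR : IsUniserialRing R) {M : Type v} [AddCommGroup M] [Module R M]
    (hM : IsSinglyProjective R M) : HasScalarFactorization R M := by
  intro x
  obtain ⟨F, _, _, _, φ, π, hπ⟩ := hM (R ∙ x) ⟨x, rfl⟩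
  let x' : (R ∙ x : Submodule R M) := ⟨x, Submodule.mem_span_singleton_self x⟩
  obtain ⟨l, m, hm⟩ := hR.exists_eq_dual_apply_smul (φ x')
  refine ⟨l (φ x'), π m, ?_, fun s hs => ?_⟩
  · rw [← map_smul, ← hm]
    exact (LinearMap.congr_fun hπ x').symm
  · have : s • x' = 0 := Subtype.ext hs
    rw [← smul_eq_mul, ← map_smul, ← map_smul, this, map_zero, map_zero]

/-- The inclusion of `R ∙ x` factors through `R` itself by `x ↦ r` and `1 ↦ m`. -/
theorem HasScalarFactorization.isSinglyProjective {R : Type u} [CommRing R]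
    {M : Type u} [AddCommGroup M] [Module R M]
    (hM : HasScalarFactorization R M) : IsSinglyProjective R M := by
  rintro _ ⟨x, rfl⟩
  obtain ⟨r, m, hx, hr⟩ := hM x
  replace hr (s : R) (hs : s • x = 0) : s • r = 0 := hr s hs
  refine ⟨R, inferInstance, inferInstance, inferInstance,
    (LinearPMap.mkSpanSingleton' x r hr).toFun, LinearMap.toSpanSingleton R M m, ?_⟩
  ext ⟨z, hz⟩
  obtain ⟨c, rfl⟩ := Submodule.mem_span_singleton.1 hz
  have := LinearPMap.mkSpanSingleton'_apply (σ := RingHom.id R) x r hr c hz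
  change LinearMap.toSpanSingleton R M m (LinearPMap.mkSpanSingleton' x r hr ⟨c • x, hz⟩) = c • x
  rw [this, LinearMap.toSpanSingleton_apply, smul_assoc, ← hx, RingHom.id_apply]

/-! ### The total quotient ring of a uniserial ring -/

theorem IsFractionRing.exists_algebraMap_mul_eq {R : Type u} [CommRing R]
    (Q : Type v) [CommRing Q] [Algebra R Q] [IsFractionRing R Q] (q : Q) :
    ∃ (a s : R) (u : Q), algebraMap R Q s * u = 1 ∧ q = algebraMap R Q a * u := by
  obtain ⟨a, s, rfl⟩ := IsLocalization.exists_mk'_eq (nonZeroDivisors R) q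
  obtain ⟨u, hu⟩ := (IsLocalization.map_units Q s).exists_right_inv
  refine ⟨a, s, u, hu, ?_⟩
  rw [IsLocalization.mk'_eq_iff_eq_mul, mul_assoc, mul_comm u, hu, mul_one]

theorem IsFractionRing.isUnit_of_mem_nonZeroDivisors_fractionRing (R : Type u) [CommRing R]
    {Q : Type v} [CommRing Q] [Algebra R Q] [IsFractionRing R Q] {q : Q}
    (hq : q ∈ nonZeroDivisors Q) : IsUnit q := by
  obtain ⟨a, s, u, hu, rfl⟩ := IsFractionRing.exists_algebraMap_mul_eq (R := R) Q q
  have ha : a ∈ nonZeroDivisors R := by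
    rw [mem_nonZeroDivisors_iff_right]
    intro z hz
    apply IsFractionRing.injective R Q
    rw [map_zero]
    refine (mem_nonZeroDivisors_iff_right.1 hq) _ ?_
    rw [← mul_assoc, ← map_mul, hz, map_zero, zero_mul]
  exact (IsLocalization.map_units Q ⟨a, ha⟩).mul (IsUnit.of_mul_eq_one_right _ hu)

theorem IsUniserialRing.isUniserialModule_fractionRing {R : Type u} [CommRing R]
    (hR : IsUniserialRing R) (Q : Type v) [CommRing Q] [Algebra R Q] [IsFractionRing R Q] :
    IsUniserialModule R Q := by
  refine isUniserialModule_of_exists_smul_eq_or fun x y => ?_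
  obtain ⟨a, s, u, hu, rfl⟩ := IsFractionRing.exists_algebraMap_mul_eq (R := R) Q x
  obtain ⟨b, t, v, hv, rfl⟩ := IsFractionRing.exists_algebraMap_mul_eq (R := R) Q y
  rcases IsUniserialModule.exists_smul_eq_or hR (a * t) (b * s) with ⟨c, hc⟩ | ⟨c, hc⟩ <;>
    have := congrArg (algebraMap R Q) hc <;>
    simp only [smul_eq_mul, map_mul] at this
  · refine Or.inl ⟨c, ?_⟩
    rw [Algebra.smul_def]
    linear_combination (u * v) * this + (-algebraMap R Q a * u) * hv +
      (algebraMap R Q c * algebraMap R Q b * v) * hu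
  · refine Or.inr ⟨c, ?_⟩
    rw [Algebra.smul_def]
    linear_combination (u * v) * this + (-algebraMap R Q b * v) * hu +
      (algebraMap R Q c * algebraMap R Q a * u) * hv

theorem IsUniserialRing.fractionRing {R : Type u} [CommRing R]
    (hR : IsUniserialRing R) (Q : Type v) [CommRing Q] [Algebra R Q] [IsFractionRing R Q] :
    IsUniserialRing Q := by
  refine isUniserialModule_of_exists_smul_eq_or fun x y => ?_
  rcases (hR.isUniserialModule_fractionRing Q).exists_smul_eq_or x y with ⟨c, hc⟩ | ⟨c, hc⟩
  · exact Or.inl ⟨algebraMap R Q c, by rw [hc, algebraMap_smul]⟩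
  · exact Or.inr ⟨algebraMap R Q c, by rw [hc, algebraMap_smul]⟩

/-- Multiplying `b ≠ 0` by a zero-divisor strictly enlarges its annihilator: if `d ≠ 0` kills `c`,
either `d` is a multiple of `b`, and the cofactor serves, or `b` is a multiple of `d` and already `b
* c = 0`. -/
theorem IsUniserialRing.exists_mul_eq_zero_ne_zero {Q : Type u} [CommRing Q]
    (hQ : IsUniserialRing Q) {b c : Q} (hc : c ∉ nonZeroDivisors Q) (hb : b ≠ 0) :
    ∃ z, z * (b * c) = 0 ∧ z * b ≠ 0 := by
  obtain ⟨d, hd, hd0⟩ : ∃ d, d * c = 0 ∧ d ≠ 0 := by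
    simpa [mem_nonZeroDivisors_iff_right] using hc
  rcases hQ.dvd_total b d with ⟨e, rfl⟩ | ⟨e, rfl⟩
  · exact ⟨e, by linear_combination hd, by rwa [mul_comm]⟩
  · exact ⟨1, by linear_combination e * hd, by rwa [one_mul]⟩

/-- Principal ideals are double annihilators when every non-zero-divisor is a unit. -/
theorem IsUniserialRing.dvd_of_annihilator_le {Q : Type u} [CommRing Q] (hQ : IsUniserialRing Q)
    (hunit : ∀ q ∈ nonZeroDivisors Q, IsUnit q) {a b : Q} (h : ∀ z, z * a = 0 → z * b = 0) :
    a ∣ b := by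
  rcases hQ.dvd_total a b with hab | ⟨c, rfl⟩
  · exact hab
  · by_cases hc : c ∈ nonZeroDivisors Q
    · exact (hunit c hc).mul_right_dvd.2 dvd_rfl
    · by_contra hb
      have hb0 : b ≠ 0 := by
        rintro rfl
        exact hb (dvd_zero _)
      obtain ⟨z, hz, hz'⟩ := hQ.exists_mul_eq_zero_ne_zero hc hb0
      exact hz' (h z hz)

theorem IsUniserialRing.exists_smul_eq_of_annihilator_le {R : Type u} [CommRing R]
    (hR : IsUniserialRing R) {Q : Type v} [CommRing Q] [Algebra R Q] [IsFractionRing R Q]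
    {r : R} {q : Q} (h : ∀ s : R, s * r = 0 → s • q = 0) : ∃ c : Q, q = r • c := by
  obtain ⟨c, hc⟩ := (hR.fractionRing Q).dvd_of_annihilator_le
    (fun _ hq => IsFractionRing.isUnit_of_mem_nonZeroDivisors_fractionRing R hq)
    (a := algebraMap R Q r) (b := q) fun z hz => by
      obtain ⟨a, s, u, hu, rfl⟩ := IsFractionRing.exists_algebraMap_mul_eq (R := R) Q z
      have har : a * r = 0 := by
        apply IsFractionRing.injective R Q
        rw [map_mul, map_zero]
        linear_combination algebraMap R Q s * hz - algebraMap R Q a * algebraMap R Q r * hu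
      have := h a har
      rw [Algebra.smul_def] at this
      linear_combination u * this
  exact ⟨c, by rw [Algebra.smul_def, hc]⟩

/-! ### Maximality and self-injectivity -/

/-- If `Q` is maximal then a homomorphism from an ideal of `R` into `Q` which is locally a
multiplication is a multiplication. -/
theorem IsMaximalRing.baer {R Q : Type u} [CommRing R] [CommRing Q] [Algebra R Q]
    (hQ : IsMaximalRing Q) (hR : IsUniserialRing R)
    (hann : ∀ (r : R) (q : Q), (∀ s : R, s * r = 0 → s • q = 0) → ∃ c : Q, q = r • c) :
    Module.Baer R Q := by
  intro J g
  have hg (j : J) : ∃ c : Q, g j = (j : R) • c := hann _ _ fun s hs => by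
    rw [← map_smul, show s • j = 0 from Subtype.ext hs, map_zero]
  choose c hc using hg
  -- The multiplier `c j` is determined only modulo the annihilator of `j`. A finite set of indices
  -- has a member dividing all the others, and its multiplier lies in all their cosets.
  obtain ⟨x, hx⟩ := hQ J c (fun j => LinearMap.ker (LinearMap.mulLeft Q (algebraMap R Q j))) <| by
    intro s
    rcases s.eq_empty_or_nonempty with rfl | hs
    · exact ⟨0, by simp⟩
    · obtain ⟨i, -, hi⟩ := IsUniserialModule.exists_mem_forall_smul_eq hR s hs (fun j : J => (j : R))
      refine ⟨c i, fun j hj => ?_⟩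
      obtain ⟨d, hd⟩ := hi j hj
      have hgj : g j = d • g i := by rw [← map_smul, show j = d • i from Subtype.ext hd]
      rw [LinearMap.mem_ker, LinearMap.mulLeft_apply, mul_sub, ← Algebra.smul_def,
        ← Algebra.smul_def, ← hc, hgj, hc, hd, smul_assoc, sub_self]
  refine ⟨LinearMap.toSpanSingleton R Q x, fun r hr => ?_⟩
  have := hx ⟨r, hr⟩
  rw [LinearMap.mem_ker, LinearMap.mulLeft_apply, mul_sub, ← Algebra.smul_def,
    ← Algebra.smul_def, ← hc, sub_eq_zero] at this
  exact this

/-- When no `L i` is smallest, multiplication by `a i` on the annihilator of `L i` glues to one map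
on the union of these annihilators. The image of `1` under an extension is the common point. -/
theorem IsUniserialRing.isMaximalRing_of_baer {Q : Type u} [CommRing Q] (hQ : IsUniserialRing Q)
    (hunit : ∀ q ∈ nonZeroDivisors Q, IsUnit q) (hbaer : Module.Baer Q Q) : IsMaximalRing Q := by
  classical
  intro I a L hfip
  have hpair (i j : I) (hij : L i ≤ L j) : a i - a j ∈ L j := by
    obtain ⟨x, hx⟩ := hfip {i, j}
    have hi := hij (hx i (by simp))
    have hj := hx j (by simp)
    simpa using (L j).sub_mem hj hi
  by_cases hmin : ∃ i, ∀ j, L i ≤ L j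
  · obtain ⟨i, hi⟩ := hmin
    exact ⟨a i, fun j => hpair i j (hi j)⟩
  push Not at hmin
  have hlt (i : I) : ∃ j, L j ≤ L i ∧ ∃ b ∈ L i, b ∉ L j := by
    obtain ⟨j, hj⟩ := hmin i
    exact ⟨j, (hQ _ _).resolve_left hj, Set.not_subset.1 hj⟩
  let A (i : I) : Ideal Q := (L i).annihilator
  have hdir : Directed (· ≤ ·) A := fun i j => by
    rcases hQ (L i) (L j) with h | h
    · exact ⟨i, le_rfl, Submodule.annihilator_mono h⟩
    · exact ⟨j, Submodule.annihilator_mono h, le_rfl⟩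
  have hwd (r : Q) (i j : I) (hi : r ∈ A i) (hj : r ∈ A j) : a i * r = a j * r := by
    wlog h : L i ≤ L j generalizing i j
    · exact (this j i hj hi ((hQ _ _).resolve_left h)).symm
    have := Submodule.mem_annihilator.1 hj _ (hpair i j h)
    rw [smul_eq_mul] at this
    linear_combination this
  rcases isEmpty_or_nonempty I with hI | hI
  · exact ⟨0, fun i => (hI.false i).elim⟩
  let J : Ideal Q := ⨆ i, A i
  have hJ (r : J) : ∃ i, (r : Q) ∈ A i := (Submodule.mem_iSup_of_directed A hdir).1 r.2
  choose k hk using hJ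
  have hkeq (r : J) (i : I) (hi : (r : Q) ∈ A i) : a (k r) * r = a i * r := hwd _ _ _ (hk r) hi
  let g : J →ₗ[Q] Q :=
    { toFun := fun r => a (k r) * r
      map_add' := fun r s => by
        obtain ⟨i, hri, hsi⟩ := hdir (k r) (k s)
        have hr := hri (hk r)
        have hs := hsi (hk s)
        rw [hkeq r i hr, hkeq s i hs, hkeq (r + s) i ((A i).add_mem hr hs), Submodule.coe_add,
          mul_add]
      map_smul' := fun c r => by
        rw [hkeq (c • r) (k r) ((A (k r)).smul_mem c (hk r)), Submodule.coe_smul, smul_eq_mul,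
          RingHom.id_apply, smul_eq_mul]
        ring }
  obtain ⟨g', hg'⟩ := hbaer J g
  have hx (i : I) (r : Q) (hr : r ∈ A i) : r * g' 1 = a i * r := by
    have hrJ : r ∈ J := le_iSup A i hr
    rw [← smul_eq_mul, ← map_smul, smul_eq_mul, mul_one, hg' r hrJ]
    exact hkeq ⟨r, hrJ⟩ i hr
  refine ⟨g' 1, fun i => ?_⟩
  obtain ⟨j, hji, b, hb, hbj⟩ := hlt i
  -- As `b ∉ L j`, the ideal `L j` lies in `(b)`, so whatever kills `b` lies in `A j` and kills `g'
  -- 1 - a j`.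
  have hdvd : b ∣ g' 1 - a j := hQ.dvd_of_annihilator_le hunit fun z hz => by
    have hzA : z ∈ A j := Submodule.mem_annihilator.2 fun n hn => by
      rcases hQ.dvd_total b n with ⟨e, rfl⟩ | ⟨e, rfl⟩
      · rw [smul_eq_mul, ← mul_assoc, hz, zero_mul]
      · exact (hbj ((L j).mul_mem_right e hn)).elim
    linear_combination hx j z hzA
  have := (L i).add_mem ((L i).mem_of_dvd hdvd hb) (hpair j i hji)
  simpa using this

/-! ### Singly projective modules over a uniserial ring with self-injective quotient ring -/

/-- The finite family `x` lifts along a map from a free module to a family satisfying the same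
linear relations. -/
def HasFreeLifts (R : Type u) [CommRing R] {M : Type u} [AddCommGroup M] [Module R M] {n : ℕ}
    (x : Fin n → M) : Prop :=
  ∃ (F : Type u) (_ : AddCommGroup F) (_ : Module R F) (_ : Module.Free R F) (v : Fin n → F)
    (π : F →ₗ[R] M), (∀ i, π (v i) = x i) ∧
      ∀ c : Fin n → R, ∑ i, c i • x i = 0 → ∑ i, c i • v i = 0

theorem HasFreeLifts.inclusionFactorsThroughFree {R : Type u} [CommRing R] {M : Type u}
    [AddCommGroup M] [Module R M] {n : ℕ} {x : Fin n → M} (h : HasFreeLifts R x) :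
    InclusionFactorsThroughFree (Submodule.span R (Set.range x)) := by
  obtain ⟨F, _, _, hF, v, π, hπ, hv⟩ := h
  rw [← Fintype.range_linearCombination]
  let ψ := Fintype.linearCombination R x
  let α := Fintype.linearCombination R v
  have hker : LinearMap.ker ψ ≤ LinearMap.ker α := fun c hc => by
    rw [LinearMap.mem_ker, Fintype.linearCombination_apply] at hc ⊢
    exact hv c hc
  refine ⟨F, _, _, hF, (LinearMap.ker ψ).liftQ α hker ∘ₗ ψ.quotKerEquivRange.symm.toLinearMap,
    π, ?_⟩
  ext ⟨_, c, rfl⟩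
  have : ψ.quotKerEquivRange.symm ⟨ψ c, LinearMap.mem_range_self ψ c⟩ =
      Submodule.Quotient.mk c := by
    rw [LinearEquiv.symm_apply_eq]
    rfl
  change π ((LinearMap.ker ψ).liftQ α hker
    (ψ.quotKerEquivRange.symm ⟨ψ c, LinearMap.mem_range_self ψ c⟩)) = ψ c
  rw [this, Submodule.liftQ_apply, Fintype.linearCombination_apply,
    Fintype.linearCombination_apply, map_sum]
  exact Finset.sum_congr rfl fun i _ => by rw [map_smul, hπ]

/-- Factor `m = r' • m'` again. A zero-divisor `r'` would give `x = (r * r') • m'` an annihilator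
strictly larger than that of `r`. -/
theorem HasScalarFactorization.exists_faithful {R : Type u} [CommRing R] (hR : IsUniserialRing R)
    {M : Type v} [AddCommGroup M] [Module R M] (hM : HasScalarFactorization R M) {x : M}
    (hx : x ≠ 0) : ∃ (r : R) (m : M), x = r • m ∧ ∀ s : R, s • m = 0 → s = 0 := by
  obtain ⟨r, m, hxm, hr⟩ := hM x
  obtain ⟨r', m', hm', hr'⟩ := hM m
  refine ⟨r, m, hxm, fun s hs => ?_⟩
  have hnzd : r' ∈ nonZeroDivisors R := by
    by_contra hc
    have hr0 : r ≠ 0 := by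
      rintro rfl
      exact hx (by rw [hxm, zero_smul])
    obtain ⟨z, hz, hz'⟩ := hR.exists_mul_eq_zero_ne_zero hc hr0
    refine hz' (hr z ?_)
    rw [hxm, hm', smul_smul, smul_smul, mul_assoc, hz, zero_smul]
  exact (mem_nonZeroDivisors_iff_right.1 hnzd) s (hr' s hs)

section FractionRing

variable {R : Type u} [CommRing R] {Q : Type u} [CommRing Q] [Algebra R Q] [IsFractionRing R Q]
  {M : Type u} [AddCommGroup M] [Module R M]

/-- If `f m' = a • 1`, then `r * a = 0`, so `m'` can be replaced by `m' - a • m`, which lies in the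
kernel. Otherwise `1` is a multiple of `f m'` and `r = 0`. -/
theorem HasScalarFactorization.ker (hR : IsUniserialRing R) (hM : HasScalarFactorization R M)
    (f : M →ₗ[R] Q) {m : M} (hm : f m = 1) : HasScalarFactorization R (LinearMap.ker f) := by
  rintro ⟨x, hx⟩
  rw [LinearMap.mem_ker] at hx
  obtain ⟨r, m', hxm, hr⟩ := hM x
  have hrf : r • f m' = 0 := by rw [← map_smul, ← hxm, hx]
  rcases (hR.isUniserialModule_fractionRing Q).exists_smul_eq_or (f m') 1 with ⟨a, ha⟩ | ⟨c, hc⟩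
  · have hra : r * a = 0 := by
      apply IsFractionRing.injective R Q
      rw [map_zero, Algebra.algebraMap_eq_smul_one, mul_smul, ← ha, hrf]
    refine ⟨r, ⟨m' - a • m, ?_⟩, Subtype.ext ?_, fun s hs => hr s (congrArg Subtype.val hs)⟩
    · rw [LinearMap.mem_ker, map_sub, map_smul, hm, ha, sub_self]
    · change x = r • (m' - a • m)
      rw [smul_sub, smul_smul, hra, zero_smul, sub_zero, hxm]
  · have hr0 : r = 0 := by
      apply IsFractionRing.injective R Q
      rw [map_zero, Algebra.algebraMap_eq_smul_one, hc, smul_comm, hrf, smul_zero]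
    refine ⟨0, 0, Subtype.ext ?_, fun s _ => mul_zero s⟩
    change x = _
    rw [hxm, hr0, zero_smul, zero_smul]
    rfl

/-- A finite family with a nonzero member in a singly projective module admits a `Q`-valued
functional which is integral on the family and splits off one of its members. -/
theorem HasScalarFactorization.exists_functional (hR : IsUniserialRing R)
    (hbaer : Module.Baer R Q) (hM : HasScalarFactorization R M) {n : ℕ} (x : Fin n → M)
    (hx : ∃ i, x i ≠ 0) :
    ∃ (f : M →ₗ[R] Q) (m : M) (g : Fin n → R) (i₀ : Fin n), f m = 1 ∧
      (∀ i, f (x i) = algebraMap R Q (g i)) ∧ x i₀ = g i₀ • m := by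
  obtain ⟨i₁, hi₁⟩ := hx
  obtain ⟨r, m, hxm, hm⟩ := hM.exists_faithful hR hi₁
  obtain ⟨f, hf⟩ := hbaer.extension_property (LinearMap.toSpanSingleton R M m)
    (LinearMap.ker_eq_bot.1 (LinearMap.ker_eq_bot'.2 fun s hs => hm s hs))
    (Algebra.linearMap R Q)
  have hfm : f m = 1 := by simpa using LinearMap.congr_fun hf 1
  obtain ⟨i₂, -, hi₂⟩ := (hR.isUniserialModule_fractionRing Q).exists_mem_forall_smul_eq
    Finset.univ ⟨i₁, Finset.mem_univ _⟩ (fun i => f (x i))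
  choose c hc using fun i => hi₂ i (Finset.mem_univ i)
  -- All values are multiples of `f (x i₂)`. If that one is integral, so are the others; if not,
  -- rescaling `f` sends `x i₂` to `1`, and `x i₂` replaces `m`.
  rcases (hR.isUniserialModule_fractionRing Q).exists_smul_eq_or (f (x i₂)) 1 with
    ⟨a, ha⟩ | ⟨a, ha⟩
  · have hg (i : Fin n) : f (x i) = algebraMap R Q (c i * a) := by
      rw [hc i, ha, smul_smul, Algebra.algebraMap_eq_smul_one]
    refine ⟨f, m, fun i => c i * a, i₁, hfm, hg, ?_⟩
    have : algebraMap R Q (c i₁ * a) = algebraMap R Q r := by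
      rw [← hg, hxm, map_smul, hfm, Algebra.algebraMap_eq_smul_one]
    exact hxm.trans (congrArg (· • m) (IsFractionRing.injective R Q this).symm)
  · have hg (i : Fin n) : (a • f) (x i) = algebraMap R Q (c i) := by
      rw [LinearMap.smul_apply, hc i, smul_comm, ← ha, Algebra.algebraMap_eq_smul_one]
    have h1 : (a • f) (x i₂) = 1 := ha.symm
    refine ⟨a • f, x i₂, c, i₂, h1, hg, ?_⟩
    have : algebraMap R Q (c i₂) = algebraMap R Q 1 := by rw [← hg, h1, map_one]
    rw [IsFractionRing.injective R Q this, one_smul]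

/-- Subtracting `g i • m` moves the family into `ker f` and kills the member at `i₀`, so induction
applies to the remaining `n` in that kernel; the factor `R` of `R × F` records the `g i`. -/
theorem HasScalarFactorization.hasFreeLifts (hR : IsUniserialRing R) (hbaer : Module.Baer R Q)
    (hM : HasScalarFactorization R M) {n : ℕ} (x : Fin n → M) : HasFreeLifts R x := by
  induction n generalizing M with
  | zero =>
    exact ⟨R, inferInstance, inferInstance, inferInstance, fun _ => 0, 0,
      fun i => i.elim0, fun _ _ => by simp⟩
  | succ n ih =>
    by_cases hx : ∃ i, x i ≠ 0
    swap
    · push Not at hx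
      exact ⟨R, inferInstance, inferInstance, inferInstance, fun _ => 0, 0,
        fun i => by simp [hx i], fun _ _ => by simp⟩
    obtain ⟨f, m, g, i₀, hm, hg, hi₀⟩ := hM.exists_functional hR hbaer x hx
    have hmem (i : Fin (n + 1)) : x i - g i • m ∈ LinearMap.ker f := by
      rw [LinearMap.mem_ker, map_sub, map_smul, hg, hm, Algebra.algebraMap_eq_smul_one, sub_self]
    let x' (i : Fin (n + 1)) : LinearMap.ker f := ⟨x i - g i • m, hmem i⟩
    have hx'₀ : x' i₀ = 0 := Subtype.ext (sub_eq_zero.2 hi₀)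
    obtain ⟨F, _, _, _, v, π, hπ, hv⟩ := ih (hM.ker hR f hm) fun j => x' (i₀.succAbove j)
    let w : Fin (n + 1) → F := Fin.insertNth (α := fun _ => F) i₀ 0 v
    have hw₀ : w i₀ = 0 := Fin.insertNth_apply_same (α := fun _ => F) i₀ 0 v
    have hw (j : Fin n) : w (i₀.succAbove j) = v j :=
      Fin.insertNth_apply_succAbove (α := fun _ => F) i₀ 0 v j
    have hπw (i : Fin (n + 1)) : π (w i) = x' i := by
      refine Fin.succAboveCases i₀ ?_ (fun j => ?_) i
      · rw [hw₀, hx'₀, map_zero]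
      · rw [hw, hπ]
    refine ⟨R × F, inferInstance, inferInstance, inferInstance, fun i => (g i, w i),
      (LinearMap.toSpanSingleton R M m).coprod ((LinearMap.ker f).subtype ∘ₗ π),
      fun i => ?_, fun c hc => ?_⟩
    · rw [LinearMap.coprod_apply, LinearMap.comp_apply, hπw]
      exact add_sub_cancel _ _
    · have hcg : ∑ i, c i * g i = 0 := by
        apply IsFractionRing.injective R Q
        rw [map_zero, ← map_zero f, ← hc, map_sum, map_sum]
        exact Finset.sum_congr rfl fun i _ => by rw [map_smul, hg, map_mul, Algebra.smul_def]
      have hcx' : ∑ i, c i • x' i = 0 := by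
        apply Subtype.ext
        rw [Submodule.coe_sum]
        calc ∑ i, c i • (x i - g i • m) = ∑ i, c i • x i - (∑ i, c i * g i) • m := by
              simp only [smul_sub, smul_smul, Finset.sum_sub_distrib, Finset.sum_smul]
          _ = 0 := by rw [hc, hcg, zero_smul, sub_zero]
      have hcw : ∑ i, c i • w i = 0 := by
        rw [Fin.sum_univ_succAbove _ i₀, hx'₀, smul_zero, zero_add] at hcx'
        rw [Fin.sum_univ_succAbove _ i₀, hw₀, smul_zero, zero_add]
        simp only [hw]
        exact hv _ hcx'
      apply Prod.ext
      · rw [Prod.fst_sum]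
        exact hcg
      · rw [Prod.snd_sum]
        exact hcw

theorem HasScalarFactorization.isFinitelyProjective (hR : IsUniserialRing R)
    (hbaer : Module.Baer R Q) (hM : HasScalarFactorization R M) : IsFinitelyProjective R M := by
  intro N hN
  obtain ⟨n, x, rfl⟩ := Submodule.fg_iff_exists_fin_generating_family.1 hN
  exact (hM.hasFreeLifts hR hbaer x).inclusionFactorsThroughFree

end FractionRing

/-! ### Essential extensions inside an injective module -/

theorem Submodule.exists_maximal_disjoint {R : Type u} [Ring R] {M : Type v} [AddCommGroup M]
    [Module R M] (A B : Submodule R M) (h : Disjoint A B) :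
    ∃ K, B ≤ K ∧ Maximal (fun K => Disjoint A K) K := by
  refine zorn_le_nonempty₀ {K | Disjoint A K} (fun c hc hchain y _ => ?_) B h
  refine ⟨sSup c, ?_, fun z hz => le_sSup hz⟩
  exact (hchain.directedOn.disjoint_sSup_right).2 fun K hK => hc hK

theorem Submodule.exists_smul_mem_of_maximal_disjoint {R : Type u} [Ring R] {M : Type v}
    [AddCommGroup M] [Module R M] {A K : Submodule R M}
    (hK : Maximal (fun K => Disjoint A K) K) {x : M} (hx : x ∉ K) :
    ∃ r : R, ∃ k ∈ K, k + r • x ∈ A ∧ k + r • x ≠ 0 := by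
  by_contra! hcon
  refine hx (hK.2 (y := K ⊔ R ∙ x) ?_ le_sup_left
    (Submodule.mem_sup_right (Submodule.mem_span_singleton_self x)))
  refine Submodule.disjoint_def.2 ?_
  intro y hy hy'
  obtain ⟨k, hk, z, hz, rfl⟩ := Submodule.mem_sup.1 hy'
  obtain ⟨r, rfl⟩ := Submodule.mem_span_singleton.1 hz
  exact hcon r k hk hy

/-- A submodule of an injective module has an injective essential extension inside it. -/
theorem Module.Baer.exists_essential {R : Type u} [Ring R] {M : Type v} [AddCommGroup M]
    [Module R M] (hM : Module.Baer R M) (N : Submodule R M) :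
    ∃ E : Submodule R M, N ≤ E ∧ Module.Baer R E ∧
      ∀ x ∈ E, x ≠ 0 → ∃ r : R, r • x ∈ N ∧ r • x ≠ 0 := by
  obtain ⟨K, -, hK⟩ := Submodule.exists_maximal_disjoint N ⊥ disjoint_bot_right
  obtain ⟨E, hNE, hE⟩ := Submodule.exists_maximal_disjoint K N hK.1.symm
  have hKE : Disjoint K E := hE.1
  have hess : ∀ x ∈ E, x ≠ 0 → ∃ r : R, r • x ∈ N ∧ r • x ≠ 0 := fun x hx hx0 => by
    have hxK : x ∉ K := fun h => hx0 (Submodule.disjoint_def.1 hKE x h hx)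
    obtain ⟨r, k, hk, hN, h0⟩ := Submodule.exists_smul_mem_of_maximal_disjoint hK hxK
    have hk0 : k = 0 := Submodule.disjoint_def.1 hKE k hk <| by
      simpa using E.sub_mem (hNE hN) (E.smul_mem r hx)
    rw [hk0, zero_add] at hN h0
    exact ⟨r, hN, h0⟩
  -- `p` extends the projection `K ⊕ E → E` to `M`. Maximality of `E` will force its range into `E`,
  -- so `E` is a retract of `M`.
  obtain ⟨p, hp⟩ := hM.extension_property (K.subtype.coprod E.subtype)
    (by
      rw [← LinearMap.ker_eq_bot, LinearMap.ker_coprod_of_disjoint_range]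
      · simp
      · simpa using hKE)
    (E.subtype ∘ₗ LinearMap.snd R K E)
  have hpK (k : M) (hk : k ∈ K) : p k = 0 := by
    simpa using LinearMap.congr_fun hp (⟨k, hk⟩, 0)
  have hpE (e : M) (he : e ∈ E) : p e = e := by
    simpa using LinearMap.congr_fun hp (0, ⟨e, he⟩)
  have hrange : LinearMap.range p ≤ E := by
    refine hE.2 (Submodule.disjoint_def.2 ?_) fun e he => ⟨e, hpE e he⟩
    rintro _ hy ⟨x, rfl⟩
    by_contra h0
    have hxK : x ∉ K := fun h => h0 (hpK x h)
    obtain ⟨r, k, hk, hN, hne⟩ := Submodule.exists_smul_mem_of_maximal_disjoint hK hxK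
    refine hne (Submodule.disjoint_def.1 hKE _ ?_ (hNE hN))
    rw [← hpE _ (hNE hN), map_add, hpK k hk, zero_add, map_smul]
    exact K.smul_mem r hy
  refine ⟨E, hNE, fun J g => ?_, hess⟩
  obtain ⟨g', hg'⟩ := hM J (E.subtype ∘ₗ g)
  refine ⟨(p.codRestrict E fun x => hrange ⟨x, rfl⟩) ∘ₗ g', fun x hx => Subtype.ext ?_⟩
  change p (g' x) = g ⟨x, hx⟩
  rw [hg' x hx]
  exact hpE _ (g ⟨x, hx⟩).2

theorem Module.exists_baer_linearMap_injective (R : Type u) [Ring R] (M : Type u) [AddCommGroup M]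
    [Module R M] : ∃ (I : Type u) (_ : AddCommGroup I) (_ : Module R I) (i : M →ₗ[R] I),
      Module.Baer R I ∧ Function.Injective i := by
  let I : ModuleCat.{u} R := CategoryTheory.Injective.under (ModuleCat.of R M)
  let i : ModuleCat.of R M ⟶ I := CategoryTheory.Injective.ι (ModuleCat.of R M)
  have : CategoryTheory.Injective (ModuleCat.of R I) :=
    CategoryTheory.Injective.injective_under (ModuleCat.of R M)
  exact ⟨I, inferInstance, inferInstance, i.hom,
    Module.Baer.of_injective (Module.injective_module_of_injective_object R I),
    (ModuleCat.mono_iff_injective i).1 inferInstance⟩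

theorem Module.exists_essential_baer (R : Type u) [Ring R] (M : Type u) [AddCommGroup M]
    [Module R M] : ∃ (E : Type u) (_ : AddCommGroup E) (_ : Module R E) (i : M →ₗ[R] E),
      Module.Baer R E ∧ Function.Injective i ∧
      ∀ x : E, x ≠ 0 → ∃ (r : R) (m : M), r • x = i m ∧ m ≠ 0 := by
  obtain ⟨I, _, _, i, hI, hi⟩ := Module.exists_baer_linearMap_injective R M
  obtain ⟨E, hE, hbaer, hess⟩ := hI.exists_essential (LinearMap.range i)
  refine ⟨E, inferInstance, inferInstance, i.codRestrict E fun m => hE ⟨m, rfl⟩, hbaer,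
    fun a b h => hi (congrArg Subtype.val h), fun x hx => ?_⟩
  obtain ⟨r, ⟨m, hm⟩, h0⟩ := hess x x.2 fun h => hx (Subtype.ext h)
  refine ⟨r, m, Subtype.ext hm.symm, ?_⟩
  rintro rfl
  exact h0 (by rw [← hm, map_zero])

/-! ### The injective hull of the total quotient ring -/

/-- Essentiality gives `s • x = i q ≠ 0`, and the double annihilator property gives `q = s * r`.
Then `x` and `r` have the same annihilator, so `r ↦ x` is well defined and extends to `Q`; `m` is
the image of `1`. -/
theorem IsUniserialRing.hasScalarFactorization_of_essential {Q : Type u} [CommRing Q]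
    (hQ : IsUniserialRing Q) (hunit : ∀ q ∈ nonZeroDivisors Q, IsUnit q)
    {E : Type v} [AddCommGroup E] [Module Q E] (hE : Module.Baer Q E) (i : Q →ₗ[Q] E)
    (hi : Function.Injective i)
    (hess : ∀ x : E, x ≠ 0 → ∃ r q : Q, r • x = i q ∧ q ≠ 0) : HasScalarFactorization Q E := by
  intro x
  by_cases hx : x = 0
  · exact ⟨0, 0, by rw [hx, smul_zero], fun s _ => mul_zero s⟩
  obtain ⟨s, q, hsq, hq⟩ := hess x hx
  have hzero (w : Q) (hw : (w * s) • x = 0) : w * q = 0 := by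
    apply hi
    rw [map_zero, ← smul_eq_mul, map_smul, ← hsq, smul_smul, hw]
  obtain ⟨r, rfl⟩ : s ∣ q := hQ.dvd_of_annihilator_le hunit fun z hz =>
    hzero z (by rw [hz, zero_smul])
  have hann (z : Q) : z • x = 0 → z * r = 0 := fun hz => by
    rcases hQ.dvd_total s z with ⟨w, rfl⟩ | ⟨w, rfl⟩
    · linear_combination hzero w (by rw [mul_comm, hz])
    · refine (hq ?_).elim
      rw [← one_mul (z * w * r)]
      exact hzero 1 (by rw [one_mul, mul_comm, mul_smul, hz, smul_zero])
  have hann' (z : Q) : z • r = 0 → z • x = 0 := fun hz => by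
    rw [smul_eq_mul] at hz
    rcases hQ.dvd_total s z with ⟨w, rfl⟩ | ⟨w, rfl⟩
    · rw [mul_comm, mul_smul, hsq, ← map_smul, smul_eq_mul,
        show w * (s * r) = 0 by linear_combination hz, map_zero]
    · exact (hq (by linear_combination w * hz)).elim
  obtain ⟨g, hg⟩ := hE (Q ∙ r) (LinearPMap.mkSpanSingleton' r x hann').toFun
  refine ⟨r, g 1, ?_, hann⟩
  rw [← map_smul, smul_eq_mul, mul_one, hg r (Submodule.mem_span_singleton_self r)]
  exact (LinearPMap.mkSpanSingleton'_apply_self r x hann' _).symm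

section RestrictScalars

variable {R : Type u} [CommRing R] {Q : Type v} [CommRing Q] [Algebra R Q] [IsFractionRing R Q]
  {E : Type v} [AddCommGroup E] [Module Q E] [Module R E] [IsScalarTower R Q E]

theorem HasScalarFactorization.restrictScalars (hE : HasScalarFactorization Q E) :
    HasScalarFactorization R E := by
  intro x
  obtain ⟨r, m, hxm, hr⟩ := hE x
  obtain ⟨a, s, u, hu, rfl⟩ := IsFractionRing.exists_algebraMap_mul_eq (R := R) Q r
  refine ⟨a, u • m, ?_, fun t ht => ?_⟩
  · rw [hxm, mul_smul, algebraMap_smul]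
  · have := hr (algebraMap R Q t) (by rwa [algebraMap_smul])
    apply IsFractionRing.injective R Q
    rw [map_mul, map_zero]
    linear_combination algebraMap R Q s * this - algebraMap R Q t * algebraMap R Q a * hu

/-- A finitely projective essential extension of `Q` is trivial. -/
theorem IsFinitelyProjective.surjective_of_essential (hR : IsUniserialRing R)
    (hE : IsFinitelyProjective R E) (i : Q →ₗ[Q] E) (hi : Function.Injective i)
    (hess : ∀ x : E, x ≠ 0 → ∃ r q : Q, r • x = i q ∧ q ≠ 0) : Function.Surjective i := by
  intro x
  let e : E := i 1
  have he (r : R) : r • e = i (algebraMap R Q r) := by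
    rw [← algebraMap_smul Q r e, ← map_smul, smul_eq_mul, mul_one]
  have he0 (r : R) (h : r • e = 0) : r = 0 := by
    rw [he] at h
    apply IsFractionRing.injective R Q
    apply hi
    rw [h, map_zero, map_zero]
  let N : Submodule R E := Submodule.span R {e, x}
  obtain ⟨F, _, _, _, φ, π, hπ⟩ := hE N (Submodule.fg_span (by simp))
  let e' : N := ⟨e, Submodule.subset_span (by simp)⟩
  let x' : N := ⟨x, Submodule.subset_span (by simp)⟩
  obtain ⟨l, m, hm⟩ := hR.exists_eq_dual_apply_smul (φ e')
  let ψ : N →ₗ[R] R := l ∘ₗ φ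
  have hψe (s : R) (h : s * ψ e' = 0) : s = 0 := by
    apply he0
    have : s • φ e' = 0 := by rw [hm, smul_smul, show s * l (φ e') = 0 from h, zero_smul]
    have h2 : s • e = π (s • φ e') := by
      rw [map_smul]
      exact congrArg (s • ·) (LinearMap.congr_fun hπ e').symm
    rw [h2, this, map_zero]
  -- `ψ` is injective on `R ∙ e'`, hence on `N` by essentiality after clearing denominators. Thus
  -- `N` embeds in `R`, where divisibility compares `e` and `x`.
  have hψ (z : N) (hz : ψ z = 0) : z = 0 := by
    by_contra hz0
    obtain ⟨r, q, hrq, hq⟩ := hess z fun h => hz0 (Subtype.ext h)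
    obtain ⟨a, s, u, hu, rfl⟩ := IsFractionRing.exists_algebraMap_mul_eq (R := R) Q r
    obtain ⟨b, t, w, hw, rfl⟩ := IsFractionRing.exists_algebraMap_mul_eq (R := R) Q q
    have key : (a * t) • z = (b * s) • e' := by
      apply Subtype.ext
      change (a * t) • (z : E) = (b * s) • e
      have := congrArg (fun y => algebraMap R Q (s * t) • y) hrq
      simp only [smul_smul, ← map_smul, smul_eq_mul] at this
      rw [he, ← algebraMap_smul Q (a * t) (z : E)]
      convert this using 2
      · simp only [map_mul]
        linear_combination (-algebraMap R Q a * algebraMap R Q t) * hu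
      · simp only [map_mul]
        linear_combination (-algebraMap R Q b * algebraMap R Q s) * hw
    have h2 := congrArg ψ key
    rw [map_smul, map_smul, hz, smul_zero, smul_eq_mul] at h2
    have h3 := congrArg (algebraMap R Q) (hψe _ h2.symm)
    rw [map_mul, map_zero] at h3
    exact hq (by linear_combination (u * w) * h3 - algebraMap R Q b * w * hu)
  rcases hR.dvd_total (ψ e') (ψ x') with ⟨r, hr⟩ | ⟨r, hr⟩
  · refine ⟨algebraMap R Q r, ?_⟩
    have : x' - r • e' = 0 := hψ _ (by rw [map_sub, map_smul, hr, smul_eq_mul]; ring)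
    rw [← he]
    exact (congrArg Subtype.val (sub_eq_zero.1 this)).symm
  · have hrx : e' - r • x' = 0 := hψ _ (by rw [map_sub, map_smul, hr, smul_eq_mul]; ring)
    have hrx' : e = r • x := congrArg Subtype.val (sub_eq_zero.1 hrx)
    have hrn : r ∈ nonZeroDivisors R := mem_nonZeroDivisors_iff_right.2 fun s hs =>
      hψe s (by rw [hr]; linear_combination ψ x' * hs)
    obtain ⟨u, hu⟩ := (IsLocalization.map_units Q (⟨r, hrn⟩ : nonZeroDivisors R)).exists_left_inv
    refine ⟨u, ?_⟩
    calc i u = u • e := by rw [← map_smul, smul_eq_mul, mul_one]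
      _ = x := by rw [hrx', ← algebraMap_smul Q r x, smul_smul, hu, one_smul]

end RestrictScalars

theorem IsUniserialRing.baer_of_isSinglyProjective_imp {R : Type u} [CommRing R]
    (hR : IsUniserialRing R) (Q : Type u) [CommRing Q] [Algebra R Q] [IsFractionRing R Q]
    (h : ∀ (M : Type u) [AddCommGroup M] [Module R M],
      IsSinglyProjective R M → IsFinitelyProjective R M) : Module.Baer Q Q := by
  obtain ⟨E, _, _, i, hE, hi, hess⟩ := Module.exists_essential_baer Q Q
  let : Module R E := Module.compHom E (algebraMap R Q)
  have : IsScalarTower R Q E := IsScalarTower.of_algebraMap_smul fun _ _ => rfl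
  have hfac : HasScalarFactorization Q E :=
    (hR.fractionRing Q).hasScalarFactorization_of_essential
      (fun _ hq => IsFractionRing.isUnit_of_mem_nonZeroDivisors_fractionRing R hq) hE i hi hess
  have hfp : IsFinitelyProjective R E :=
    h E (HasScalarFactorization.restrictScalars (R := R) hfac).isSinglyProjective
  exact hE.of_equiv (LinearEquiv.ofBijective i ⟨hi, hfp.surjective_of_essential hR i hi hess⟩).symm

theorem mainTheorem1 {R : Type u} [CommRing R] (hR : IsUniserialRing R)
    (Q : Type u) [CommRing Q] [Algebra R Q] [IsFractionRing R Q] :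
    (IsSelfInjective Q ↔
      ∀ (M : Type u) [AddCommGroup M] [Module R M],
        IsSinglyProjective R M → IsFinitelyProjective R M) ∧
    (IsSelfInjective Q ↔ IsMaximalRing Q) := by
  have hQ : IsUniserialRing Q := hR.fractionRing Q
  have hunit : ∀ q ∈ nonZeroDivisors Q, IsUnit q :=
    fun _ hq => IsFractionRing.isUnit_of_mem_nonZeroDivisors_fractionRing R hq
  have hmax (h : IsSelfInjective Q) : IsMaximalRing Q :=
    hQ.isMaximalRing_of_baer hunit (Module.Baer.of_injective h)
  refine ⟨⟨fun h M _ _ hM => ?_, fun h => ?_⟩, hmax, fun h => ?_⟩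
  -- Self-injectivity of `Q` is turned into injectivity over `R` by way of maximality.
  · exact (hM.hasScalarFactorization hR).isFinitelyProjective hR
      ((hmax h).baer hR fun _ _ => hR.exists_smul_eq_of_annihilator_le)
  · exact (hR.baer_of_isSinglyProjective_imp Q h).injective
  · refine (h.baer hQ fun r q hrq => ?_).injective
    obtain ⟨c, hc⟩ := hQ.dvd_of_annihilator_le hunit hrq
    exact ⟨c, hc⟩
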